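/- Let $r_s>0$ and $\tilde k\in\mathbb R$, and put $\zeta:=\sqrt{1+3\tilde k^2}$ and $x:=1-\frac{r_s}{\rho}$. The \emph{special Buchdahl-inspired metric} in the coordinates $(t,\rho,\theta,\phi)$ is $$ds^2=|x|^{\tilde k}\Bigl\{-x\,dt^2+\frac{1}{x}\,\frac{r^4(\rho)}{\rho^4}\,d\rho^2+r^2(\rho)\bigl(d\theta^2+\sin^2\theta\,d\phi^2\bigr)\Bigr\},\qquad r(\rho):=\frac{\zeta\,r_s\,|x|^{\frac12(\zeta-1)}}{\bigl|1-\operatorname{sgn}(x)|x|^{\zeta}\bigr|}.$$ Let $K:=\mathcal R^{\mu\nu\rho\sigma}\mathcal R_{\mu\nu\rho\sigma}$ be its Kretschmann scalar, and write $A:=4\tilde k^3-5\tilde k^2-3$ and $B:=9\tilde k^4-2\tilde k^3+10\tilde k^2+3$. (1) At every point with $\rho\in\mathbb R\setminus\{0,r_s\}$ and $\sin\theta\ne0$, $$K=\frac{2}{\zeta^{8}r_s^{4}}\bigl(1-\operatorname{sgn}(x)|x|^{\zeta}\bigr)^{6}|x|^{2-4\zeta-2\tilde k}\Bigl\{4\tilde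 k^{2}(\tilde k+1)\operatorname{sgn}(x)|x|^{\zeta}+\zeta A\bigl(1-|x|^{2\zeta}\bigr)+B\bigl(1+|x|^{2\zeta}\bigr)\Bigr\},$$ and $K>0$. In (2)--(4), $t,\theta,\phi$ are fixed, with $\sin\theta\neq 0$, and limits are two-sided in $\rho$. (2) For every $\tilde k$, as $\rho\to0$, $$K\sim\frac{2}{\zeta^8r_s^4}\,(B-\zeta A)\,\Bigl|\frac{r_s}{\rho}\Bigr|^{2(2\zeta-\tilde k+1)},$$ where $2\zeta-\tilde k+1>0$ and $B-\zeta A>0$; in particular $K\to+\infty$. (3) If $\tilde k\ne0$ and $\tilde k\ne-1$, then as $\rho\to r_s$, $$K\sim\frac{2}{\zeta^8r_s^4}\,(B+\zeta A)\,\Bigl|1-\frac{r_s}{\rho}\Bigr|^{2(1-2\zeta-\tilde k)},$$ where $1-2\zeta-\tilde k<0$ and $B+\zeta A>0$; in particular $K$ is bounded above and below by positive multiples of $|\rho-r_s|^{2(1-2\zeta-\tilde k)}$ near $\rho=r_s$, and $K\to+\infty$. (4) As $\rho\to r_s$, $K\to12\,r_s^{-4}$ if $\tilde k=0$, and $K\to\frac38\,r_s^{-4}$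 if $\tilde k=-1$. -/

import Mathlib

open Filter Topology Asymptotics

noncomputable section

/-! Curvature of a metric given by its matrix of components in a chart of dimension four. -/

/-- A point of the chart, with coordinates `x 0, x 1, x 2, x 3`. -/
abbrev Chart : Type := Fin 4 → ℝ

/-- The matrix of components of a metric tensor in the chart. -/
abbrev MetricField : Type := Chart → Matrix (Fin 4) (Fin 4) ℝ

/-- The coordinate partial derivative `∂_i f` at the point `x`. -/
def partialDeriv (i : Fin 4) (f : Chart → ℝ) (x : Chart) : ℝ :=
  deriv (fun s : ℝ => f (Function.update x i s)) (x i)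

/-- The Christoffel symbols `Γ^a_{bc}` of the Levi-Civita connection. -/
def christoffel (g : MetricField) (a b c : Fin 4) (x : Chart) : ℝ :=
  (1 / 2) * ∑ d : Fin 4, (g x)⁻¹ a d *
    (partialDeriv b (fun y => g y d c) x + partialDeriv c (fun y => g y d b) x
      - partialDeriv d (fun y => g y b c) x)

/-- The Riemann tensor `R^a_{bcd}`
`= ∂_c Γ^a_{db} - ∂_d Γ^a_{cb} + Γ^a_{ce} Γ^e_{db} - Γ^a_{de} Γ^e_{cb}`. -/
def riemannUp (g : MetricField) (a b c d : Fin 4) (x : Chart) : ℝ :=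
  partialDeriv c (christoffel g a d b) x - partialDeriv d (christoffel g a c b) x
    + ∑ e : Fin 4, (christoffel g a c e x * christoffel g e d b x
        - christoffel g a d e x * christoffel g e c b x)

/-- The covariant Riemann tensor `R_{abcd} = g_{ae} R^e_{bcd}`. -/
def riemannLow (g : MetricField) (a b c d : Fin 4) (x : Chart) : ℝ :=
  ∑ e : Fin 4, g x a e * riemannUp g e b c d x

/-- The contravariant Riemann tensor `R^{abcd} = g^{bf} g^{cg} g^{dh} R^a_{fgh}`. -/
def riemannContra (g : MetricField) (a b c d : Fin 4) (x : Chart) : ℝ :=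
  ∑ p : Fin 4, ∑ q : Fin 4, ∑ r : Fin 4,
    (g x)⁻¹ b p * (g x)⁻¹ c q * (g x)⁻¹ d r * riemannUp g a p q r x

/-- The Kretschmann scalar `K = R^{abcd} R_{abcd}`. -/
def kretschmann (g : MetricField) (x : Chart) : ℝ :=
  ∑ a : Fin 4, ∑ b : Fin 4, ∑ c : Fin 4, ∑ d : Fin 4,
    riemannContra g a b c d x * riemannLow g a b c d x

/-! The special Buchdahl-inspired metric, in the coordinates `(t, ρ, θ, φ)`. -/

/-- `ζ = √(1 + 3 k²)`, where `k` is the rescaled (dimensionless) Buchdahl parameter. -/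
def zeta (k : ℝ) : ℝ := Real.sqrt (1 + 3 * k ^ 2)

/-- `x = 1 - r_s / ρ`. -/
def xOf (rs ρ : ℝ) : ℝ := 1 - rs / ρ

/-- `sgn(x) |x|^ζ`. -/
def signedPow (x ζ : ℝ) : ℝ := Real.sign x * |x| ^ ζ

/-- The areal coordinate `r(ρ)`. -/
def arealRadius (rs k ρ : ℝ) : ℝ :=
  zeta k * rs * |xOf rs ρ| ^ ((zeta k - 1) / 2) / |1 - signedPow (xOf rs ρ) (zeta k)|

/-- The special Buchdahl-inspired metric
`|x|^k { -x dt² + x⁻¹ (r(ρ)⁴ / ρ⁴) dρ² + r(ρ)² (dθ² + sin² θ dφ²) }`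
at the point `p = (t, ρ, θ, φ)`, with `x = 1 - r_s / ρ`. -/
def specialMetric (rs k : ℝ) : MetricField := fun p =>
  |xOf rs (p 1)| ^ k • Matrix.diagonal
    ![-(xOf rs (p 1)),
      (xOf rs (p 1))⁻¹ * (arealRadius rs k (p 1) ^ 4 / (p 1) ^ 4),
      arealRadius rs k (p 1) ^ 2,
      arealRadius rs k (p 1) ^ 2 * Real.sin (p 2) ^ 2]

/-- The polynomial `4 k³ - 5 k² - 3`. -/
def polyA (k : ℝ) : ℝ := 4 * k ^ 3 - 5 * k ^ 2 - 3

/-- The polynomial `9 k⁴ - 2 k³ + 10 k² + 3`. -/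
def polyB (k : ℝ) : ℝ := 9 * k ^ 4 - 2 * k ^ 3 + 10 * k ^ 2 + 3

/-- The closed form of the Kretschmann scalar as a function of `x = 1 - r_s / ρ`. -/
def kretschmannClosed (rs k x : ℝ) : ℝ :=
  2 / (zeta k ^ 8 * rs ^ 4) * (1 - signedPow x (zeta k)) ^ 6
    * |x| ^ (2 - 4 * zeta k - 2 * k)
    * (4 * k ^ 2 * (k + 1) * signedPow x (zeta k)
        + zeta k * polyA k * (1 - |x| ^ (2 * zeta k))
        + polyB k * (1 + |x| ^ (2 * zeta k)))

end

/-! The metric is diagonal with components `a, b, c, c sin² θ` depending on `ρ` alone apart from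
`sin² θ`. For such a metric the Riemann tensor is determined by the sectional curvatures of the six
coordinate planes, and `K` is four times the sum of their squares (`kretschmann_sphericalMetric`).
Here the components are products of powers, so their logarithmic derivatives are simple rational
expressions.

Write `S = sgn(x)|x|^ζ`. Every sectional curvature is a common factor times a polynomial in `S`,
`ζ`, `k`, and the weighted sum of squares collapses to the closed form once `ζ² = 1 + 3k²` is used
(`sphericalKretschmann_eq`, `sum_sq_eq_closed`).

The bracket of the closed form is the quadratic `(B - ζA)S² + 4k²(k+1)S + (B + ζA)`. Its leading
coefficient is positive. Its discriminant is `-4k²(k+1)²` times a positive quartic, so it is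
negative unless `k = 0` or `k = -1`; there the quadratic is a positive multiple of `S²`. Since `S ≠
0`, this gives `K > 0` (`closed_factor_pos`).

At `ρ → 0` one has `1/S → 0` and the leading coefficient governs `K`; at `ρ → r_s` one has `S → 0`
and the constant term does. In the two exceptional cases the constant term vanishes and `S²` exactly
cancels the divergent power of `|x|`, leaving a finite limit. -/

noncomputable section

/-! ### Curvature of a static spherically symmetric metric. -/

/-- The static spherically symmetric metric with components `a, b, c, c sin² θ`. -/
def sphericalMetric (a b c : ℝ → ℝ) : MetricField := fun p =>
  Matrix.diagonal ![a (p 1), b (p 1), c (p 1), c (p 1) * Real.sin (p 2) ^ 2]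

/-- The components `a, b, c` do not vanish on the open set `U`, where they have logarithmic
derivatives `u, v, w`. -/
structure HasLogDerivs (U : Set ℝ) (a b c u v w : ℝ → ℝ) : Prop where
  isOpen : IsOpen U
  a_ne : ∀ s ∈ U, a s ≠ 0
  b_ne : ∀ s ∈ U, b s ≠ 0
  c_ne : ∀ s ∈ U, c s ≠ 0
  a_deriv : ∀ s ∈ U, HasDerivAt a (a s * u s) s
  b_deriv : ∀ s ∈ U, HasDerivAt b (b s * v s) s
  c_deriv : ∀ s ∈ U, HasDerivAt c (c s * w s) s

theorem inv_sphericalMetric {a b c : ℝ → ℝ} {p : Chart} (ha : a (p 1) ≠ 0) (hb : b (p 1) ≠ 0)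
    (hc : c (p 1) ≠ 0) (hs : Real.sin (p 2) ≠ 0) :
    (sphericalMetric a b c p)⁻¹ = Matrix.diagonal
      ![(a (p 1))⁻¹, (b (p 1))⁻¹, (c (p 1))⁻¹, (c (p 1) * Real.sin (p 2) ^ 2)⁻¹] := by
  apply Matrix.inv_eq_right_inv
  rw [sphericalMetric, Matrix.diagonal_mul_diagonal, ← Matrix.diagonal_one]
  congr 1
  funext i
  fin_cases i
  · simp [ha]
  · simp [hb]
  · simp [hc]
  · exact mul_inv_cancel₀ (mul_ne_zero hc (pow_ne_zero 2 hs))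

/-- The components of `∂_i g` for the spherical metric, in terms of `a, b, c`, their logarithmic
derivatives, and the sine and cosine of the polar angle. -/
def sphericalDeriv (a b c u v w s t : ℝ) (i : Fin 4) : Matrix (Fin 4) (Fin 4) ℝ :=
  Matrix.diagonal (![0, ![a * u, b * v, c * w, c * w * s ^ 2], ![0, 0, 0, c * (2 * s * t)], 0] i)

theorem partialDeriv_sphericalMetric {U : Set ℝ} {a b c u v w : ℝ → ℝ}
    (h : HasLogDerivs U a b c u v w) {p : Chart} (hp : p 1 ∈ U) (i d e : Fin 4) :
    partialDeriv i (fun y => sphericalMetric a b c y d e) p =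
      sphericalDeriv (a (p 1)) (b (p 1)) (c (p 1)) (u (p 1)) (v (p 1)) (w (p 1))
        (Real.sin (p 2)) (Real.cos (p 2)) i d e := by
  have ha := (h.a_deriv _ hp).deriv
  have hb := (h.b_deriv _ hp).deriv
  have hc := (h.c_deriv _ hp).deriv
  have hc' := ((h.c_deriv _ hp).mul_const (Real.sin (p 2) ^ 2)).deriv
  have hs := (((Real.hasDerivAt_sin (p 2)).pow 2).const_mul (c (p 1))).deriv
  by_cases hde : d = e
  · subst hde
    unfold partialDeriv sphericalMetric sphericalDeriv
    simp only [Matrix.diagonal_apply_eq]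
    fin_cases i <;> fin_cases d <;> simp [ha, hb, hc, hc', Function.update]
  · simp [partialDeriv, sphericalMetric, sphericalDeriv, Matrix.diagonal_apply_ne _ hde]

/-- The Christoffel symbols of the spherical metric. -/
def sphericalChristoffel (a b c u v w s t : ℝ) : Fin 4 → Fin 4 → Fin 4 → ℝ :=
  ![![![0, u / 2, 0, 0], ![u / 2, 0, 0, 0], ![0, 0, 0, 0], ![0, 0, 0, 0]],
    ![![-(a * u / (2 * b)), 0, 0, 0], ![0, v / 2, 0, 0], ![0, 0, -(c * w / (2 * b)), 0],
      ![0, 0, 0, -(c * w / (2 * b) * s ^ 2)]],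
    ![![0, 0, 0, 0], ![0, 0, w / 2, 0], ![0, w / 2, 0, 0], ![0, 0, 0, -(s * t)]],
    ![![0, 0, 0, 0], ![0, 0, 0, w / 2], ![0, 0, 0, t / s], ![0, w / 2, t / s, 0]]]

theorem christoffel_sphericalMetric {U : Set ℝ} {a b c u v w : ℝ → ℝ}
    (h : HasLogDerivs U a b c u v w) {p : Chart} (hp : p 1 ∈ U) (hs : Real.sin (p 2) ≠ 0)
    (i j l : Fin 4) :
    christoffel (sphericalMetric a b c) i j l p =
      sphericalChristoffel (a (p 1)) (b (p 1)) (c (p 1)) (u (p 1)) (v (p 1)) (w (p 1))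
        (Real.sin (p 2)) (Real.cos (p 2)) i j l := by
  have ha := h.a_ne _ hp
  have hb := h.b_ne _ hp
  have hc := h.c_ne _ hp
  simp only [christoffel, partialDeriv_sphericalMetric h hp, inv_sphericalMetric ha hb hc hs]
  generalize a (p 1) = a at *
  generalize b (p 1) = b at *
  generalize c (p 1) = c at *
  generalize Real.sin (p 2) = s at *
  fin_cases i <;> fin_cases j <;> fin_cases l <;>
    simp [sphericalDeriv, sphericalChristoffel, Matrix.diagonal_apply] <;>
    field_simp

/-- The derivatives of the Christoffel symbols of the spherical metric, where `u', v', w'` are the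
derivatives of the logarithmic derivatives `u, v, w`. -/
def sphericalChristoffelDeriv (a b c u v w u' v' w' s t : ℝ) :
    Fin 4 → Fin 4 → Fin 4 → Fin 4 → ℝ :=
  ![0,
    ![![![0, u' / 2, 0, 0], ![u' / 2, 0, 0, 0], ![0, 0, 0, 0], ![0, 0, 0, 0]],
      ![![-(a * (u ^ 2 - u * v + u') / (2 * b)), 0, 0, 0], ![0, v' / 2, 0, 0],
        ![0, 0, -(c * (w ^ 2 - w * v + w') / (2 * b)), 0],
        ![0, 0, 0, -(c * (w ^ 2 - w * v + w') / (2 * b) * s ^ 2)]],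
      ![![0, 0, 0, 0], ![0, 0, w' / 2, 0], ![0, w' / 2, 0, 0], ![0, 0, 0, 0]],
      ![![0, 0, 0, 0], ![0, 0, 0, w' / 2], ![0, 0, 0, 0], ![0, w' / 2, 0, 0]]],
    ![0,
      ![![0, 0, 0, 0], ![0, 0, 0, 0], ![0, 0, 0, 0],
        ![0, 0, 0, -(c * w / (2 * b) * (2 * s * t))]],
      ![![0, 0, 0, 0], ![0, 0, 0, 0], ![0, 0, 0, 0], ![0, 0, 0, s ^ 2 - t ^ 2]],
      ![![0, 0, 0, 0], ![0, 0, 0, 0], ![0, 0, 0, -(1 / s ^ 2)], ![0, 0, -(1 / s ^ 2), 0]]],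
    0]

/-- The symbols `Γ^1_{00}` and `Γ^1_{22}` share this form, with `(a, u)` and `(c, w)` in turn;
`Γ^1_{33}` is the latter times `sin² θ`. -/
theorem hasDerivAt_mul_div {a b u v : ℝ → ℝ} {r u' : ℝ} (hb : b r ≠ 0)
    (ha : HasDerivAt a (a r * u r) r) (hbd : HasDerivAt b (b r * v r) r)
    (hu : HasDerivAt u u' r) :
    HasDerivAt (fun x => -(a x * u x / (2 * b x)))
      (-(a r * (u r ^ 2 - u r * v r + u') / (2 * b r))) r := by
  have h := ((ha.mul hu).div (hbd.const_mul 2) (by positivity)).neg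
  refine h.congr_deriv ?_
  simp only [Pi.mul_apply]
  field_simp
  ring

theorem partialDeriv_christoffel_sphericalMetric {U : Set ℝ} {a b c u v w : ℝ → ℝ}
    (h : HasLogDerivs U a b c u v w) {p : Chart} (hp : p 1 ∈ U) (hs : Real.sin (p 2) ≠ 0)
    {u' v' w' : ℝ} (hu : HasDerivAt u u' (p 1)) (hv : HasDerivAt v v' (p 1))
    (hw : HasDerivAt w w' (p 1)) (m i j l : Fin 4) :
    partialDeriv m (christoffel (sphericalMetric a b c) i j l) p =
      sphericalChristoffelDeriv (a (p 1)) (b (p 1)) (c (p 1)) (u (p 1)) (v (p 1)) (w (p 1))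
        u' v' w' (Real.sin (p 2)) (Real.cos (p 2)) m i j l := by
  -- The table of Christoffel symbols is valid only where `ρ ∈ U` and `sin θ ≠ 0`. These are open
  -- conditions, so the table holds along the coordinate line near `p` and may be differentiated
  -- entry by entry.
  have key : ∀ f : ℝ → ℝ, (∀ᶠ x in 𝓝 (p m),
      sphericalChristoffel (a (Function.update p m x 1)) (b (Function.update p m x 1))
        (c (Function.update p m x 1)) (u (Function.update p m x 1)) (v (Function.update p m x 1))
        (w (Function.update p m x 1)) (Real.sin (Function.update p m x 2))
        (Real.cos (Function.update p m x 2)) i j l = f x) →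
      partialDeriv m (christoffel (sphericalMetric a b c) i j l) p = deriv f (p m) := by
    intro f hf
    apply Filter.EventuallyEq.deriv_eq
    have hcont : Continuous fun x : ℝ => Function.update p m x := by fun_prop
    have h1 : ∀ᶠ x in 𝓝 (p m), Function.update p m x 1 ∈ U := by
      apply ((continuous_apply 1).comp hcont).continuousAt.eventually_mem
      simpa using h.isOpen.mem_nhds hp
    have h2 : ∀ᶠ x in 𝓝 (p m), Real.sin (Function.update p m x 2) ≠ 0 := by
      apply (Real.continuous_sin.comp ((continuous_apply 2).comp hcont)).continuousAt.eventually_ne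
      simpa using hs
    filter_upwards [hf, h1, h2] with x hx h1 h2
    rw [← hx, christoffel_sphericalMetric h h1 h2]
  rw [key _ (Eventually.of_forall fun x => rfl)]
  have hb := h.b_ne _ hp
  have da := (hasDerivAt_mul_div hb (h.a_deriv _ hp) (h.b_deriv _ hp) hu).deriv
  have dc := hasDerivAt_mul_div hb (h.c_deriv _ hp) (h.b_deriv _ hp) hw
  have dcs : HasDerivAt (fun x => -(c x * w x / (2 * b x) * Real.sin (p 2) ^ 2)) _ (p 1) :=
    (dc.mul_const (Real.sin (p 2) ^ 2)).congr_of_eventuallyEq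
      (Eventually.of_forall fun x => (neg_mul _ _).symm)
  have hsin := Real.hasDerivAt_sin (p 2)
  have hcos := Real.hasDerivAt_cos (p 2)
  have hsc := Real.sin_sq_add_cos_sq (p 2)
  have dsc : HasDerivAt (fun x => -(Real.sin x * Real.cos x))
      (Real.sin (p 2) ^ 2 - Real.cos (p 2) ^ 2) (p 2) :=
    (hsin.mul hcos).neg.congr_deriv (by ring)
  have dcot : HasDerivAt (fun x => Real.cos x / Real.sin x) (-(1 / Real.sin (p 2) ^ 2)) (p 2) :=
    (hcos.div hsin hs).congr_deriv (by field_simp; linarith)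
  have dss : HasDerivAt (fun x => -(c (p 1) * w (p 1) / (2 * b (p 1)) * Real.sin x ^ 2))
      (-(c (p 1) * w (p 1) / (2 * b (p 1)) * (2 * Real.sin (p 2) * Real.cos (p 2)))) (p 2) :=
    ((hsin.pow 2).const_mul (c (p 1) * w (p 1) / (2 * b (p 1)))).neg.congr_deriv (by simp)
  have h0 : deriv (fun _ : ℝ => (0 : ℝ)) (p m) = 0 := deriv_const _ _
  fin_cases m
  · simp [sphericalChristoffelDeriv, deriv_const]
  · simp only [Fin.mk_one, Function.update_self]
    have e2 : ∀ x, Function.update p 1 x 2 = p 2 := fun x => by simp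
    simp only [e2]
    fin_cases i <;> fin_cases j <;> fin_cases l <;>
    first
    | exact h0
    | exact deriv_const _ _
    | exact (hu.div_const 2).deriv
    | exact (hv.div_const 2).deriv
    | exact (hw.div_const 2).deriv
    | exact da
    | exact dc.deriv
    | exact (dcs.congr_deriv (neg_mul _ _)).deriv
  · have e2 : ∀ x, Function.update p 2 x 1 = p 1 := fun x => by simp
    simp only [Fin.reduceFinMk, Function.update_self, e2]
    fin_cases i <;> fin_cases j <;> fin_cases l <;>
    first
    | exact h0
    | exact deriv_const _ _
    | exact dss.deriv
    | exact dsc.deriv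
    | exact dcot.deriv
  · simp [sphericalChristoffelDeriv, deriv_const]

/-- The sectional curvatures of the coordinate planes of the spherical metric. -/
def sphericalCurvature (b c u v w u' w' : ℝ) : Matrix (Fin 4) (Fin 4) ℝ :=
  let K₁ := -((2 * u' + u ^ 2 - u * v) / (4 * b))
  let K₂ := -(u * w / (4 * b))
  let K₃ := -((2 * w' + w ^ 2 - w * v) / (4 * b))
  let K₄ := 1 / c - w ^ 2 / (4 * b)
  ![![0, K₁, K₂, K₂], ![K₁, 0, K₃, K₃], ![K₂, K₃, 0, K₄], ![K₂, K₃, K₄, 0]]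

-- Each coordinate plane contributes one sectional curvature and the mixed components vanish. The
-- derivative `v'` enters through `Γ^1_{11}` but cancels by antisymmetry in the last two indices.
set_option maxHeartbeats 4000000 in
theorem riemannUp_sphericalMetric {U : Set ℝ} {a b c u v w : ℝ → ℝ}
    (h : HasLogDerivs U a b c u v w) {p : Chart} (hp : p 1 ∈ U) (hs : Real.sin (p 2) ≠ 0)
    {u' v' w' : ℝ} (hu : HasDerivAt u u' (p 1)) (hv : HasDerivAt v v' (p 1))
    (hw : HasDerivAt w w' (p 1)) (i j l m : Fin 4) :
    riemannUp (sphericalMetric a b c) i j l m p =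
      sphericalCurvature (b (p 1)) (c (p 1)) (u (p 1)) (v (p 1)) (w (p 1)) u' w' i j *
        ((1 : Matrix (Fin 4) (Fin 4) ℝ) i l * sphericalMetric a b c p j m
          - (1 : Matrix (Fin 4) (Fin 4) ℝ) i m * sphericalMetric a b c p j l) := by
  have ha := h.a_ne _ hp
  have hb := h.b_ne _ hp
  have hc := h.c_ne _ hp
  simp only [riemannUp, partialDeriv_christoffel_sphericalMetric h hp hs hu hv hw,
    christoffel_sphericalMetric h hp hs, sphericalMetric]
  have hsc := Real.cos_sq' (p 2)
  generalize a (p 1) = a at *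
  generalize b (p 1) = b at *
  generalize c (p 1) = c at *
  generalize Real.sin (p 2) = s at *
  generalize Real.cos (p 2) = t at *
  fin_cases i <;> fin_cases j <;> fin_cases l <;> fin_cases m <;>
    simp [Fin.sum_univ_four, sphericalCurvature, sphericalChristoffel, sphericalChristoffelDeriv] <;>
    field_simp <;> (try rw [hsc]) <;> ring

/-- For fixed `i ≠ j` only `(l, m) = (i, j)` and `(j, i)` survive. In each the metric factors of the
covariant and contravariant components cancel, leaving `κ i j ^ 2`; hence the factor 2. -/
theorem kretschmann_eq_of_riemannUp {g : MetricField} {p : Chart} {d : Fin 4 → ℝ}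
    {κ : Matrix (Fin 4) (Fin 4) ℝ} (hd : ∀ i, d i ≠ 0) (hg : g p = Matrix.diagonal d)
    (hg' : (g p)⁻¹ = Matrix.diagonal fun i => (d i)⁻¹)
    (hκ : ∀ i, κ i i = 0)
    (hR : ∀ i j l m, riemannUp g i j l m p = κ i j *
      ((1 : Matrix (Fin 4) (Fin 4) ℝ) i l * g p j m
        - (1 : Matrix (Fin 4) (Fin 4) ℝ) i m * g p j l)) :
    kretschmann g p = 2 * ∑ i, ∑ j, κ i j ^ 2 := by
  have hlow : ∀ i j l m, riemannLow g i j l m p = d i * riemannUp g i j l m p := by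
    intro i j l m
    simp [riemannLow, hg, Matrix.diagonal_apply]
  have hcon : ∀ i j l m, riemannContra g i j l m p =
      (d j)⁻¹ * (d l)⁻¹ * (d m)⁻¹ * riemannUp g i j l m p := by
    intro i j l m
    simp [riemannContra, hg', Matrix.diagonal_apply]
  simp only [kretschmann, hlow, hcon, Finset.mul_sum]
  refine Finset.sum_congr rfl fun i _ => Finset.sum_congr rfl fun j _ => ?_
  simp only [hR, hg]
  by_cases hij : i = j
  · subst hij
    simp [hκ]
  · have hi := hd i
    have hj := hd j
    rw [← Finset.sum_subset (Finset.subset_univ {i, j})]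
    · rw [Finset.sum_pair hij, ← Finset.sum_subset (Finset.subset_univ {i, j}),
        ← Finset.sum_subset (Finset.subset_univ {i, j}), Finset.sum_pair hij, Finset.sum_pair hij]
      · simp [hij, Ne.symm hij]
        field_simp
        ring
      · intro l _ hl
        simp only [Finset.mem_insert, Finset.mem_singleton, not_or] at hl
        simp [Ne.symm hl.1, Ne.symm hl.2, hij]
      · intro l _ hl
        simp only [Finset.mem_insert, Finset.mem_singleton, not_or] at hl
        simp [Matrix.diagonal_apply, Ne.symm hl.1, Ne.symm hl.2]
    · intro l _ hl
      simp only [Finset.mem_insert, Finset.mem_singleton, not_or] at hl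
      simp [Matrix.diagonal_apply, Matrix.one_apply, Ne.symm hl.1, Ne.symm hl.2]

theorem kretschmann_sphericalMetric {U : Set ℝ} {a b c u v w : ℝ → ℝ}
    (h : HasLogDerivs U a b c u v w) {p : Chart} (hp : p 1 ∈ U) (hs : Real.sin (p 2) ≠ 0)
    {u' v' w' : ℝ} (hu : HasDerivAt u u' (p 1)) (hv : HasDerivAt v v' (p 1))
    (hw : HasDerivAt w w' (p 1)) :
    kretschmann (sphericalMetric a b c) p =
      4 * ((2 * u' + u (p 1) ^ 2 - u (p 1) * v (p 1)) / (4 * b (p 1))) ^ 2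
        + 8 * (u (p 1) * w (p 1) / (4 * b (p 1))) ^ 2
        + 8 * ((2 * w' + w (p 1) ^ 2 - w (p 1) * v (p 1)) / (4 * b (p 1))) ^ 2
        + 4 * (1 / c (p 1) - w (p 1) ^ 2 / (4 * b (p 1))) ^ 2 := by
  have ha := h.a_ne _ hp
  have hb := h.b_ne _ hp
  have hc := h.c_ne _ hp
  have hd : ∀ i, ![a (p 1), b (p 1), c (p 1), c (p 1) * Real.sin (p 2) ^ 2] i ≠ 0 := by
    intro i
    fin_cases i
    exacts [ha, hb, hc, mul_ne_zero hc (pow_ne_zero 2 hs)]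
  have hinv : (sphericalMetric a b c p)⁻¹ = Matrix.diagonal fun i =>
      (![a (p 1), b (p 1), c (p 1), c (p 1) * Real.sin (p 2) ^ 2] i)⁻¹ := by
    rw [inv_sphericalMetric ha hb hc hs]
    congr 1
    funext i
    fin_cases i <;> rfl
  have hκ : ∀ i, sphericalCurvature (b (p 1)) (c (p 1)) (u (p 1)) (v (p 1)) (w (p 1)) u' w' i i
      = 0 := by
    intro i
    fin_cases i <;> rfl
  rw [kretschmann_eq_of_riemannUp (g := sphericalMetric a b c) hd rfl hinv hκ
    (riemannUp_sphericalMetric h hp hs hu hv hw)]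
  simp only [Fin.sum_univ_four, sphericalCurvature, Matrix.cons_val]
  ring

/-! ### Signed powers and the coordinate `x`. -/

theorem sq_zeta (k : ℝ) : zeta k ^ 2 = 1 + 3 * k ^ 2 := Real.sq_sqrt (by positivity)

theorem zeta_pos (k : ℝ) : 0 < zeta k := Real.sqrt_pos.2 (by positivity)

/-- This form has no sign function, so away from zero it can be differentiated as a product. -/
theorem signedPow_eq {x : ℝ} (hx : x ≠ 0) (z : ℝ) : signedPow x z = x * |x| ^ (z - 1) := by
  have h : 0 < |x| := abs_pos.2 hx
  rw [signedPow, Real.rpow_sub_one h.ne', ← mul_div_assoc, mul_comm x, mul_div_assoc, mul_comm]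
  congr 1
  rcases lt_or_gt_of_ne hx with h | h
  · rw [Real.sign_of_neg h, abs_of_neg h]
    field_simp
  · rw [Real.sign_of_pos h, abs_of_pos h]
    field_simp

theorem sq_signedPow {x : ℝ} (hx : x ≠ 0) (z : ℝ) : signedPow x z ^ 2 = |x| ^ (2 * z) := by
  rw [signedPow, mul_pow, ← Real.rpow_natCast (|x| ^ z), ← Real.rpow_mul (abs_nonneg x)]
  rcases lt_or_gt_of_ne hx with h | h
  · rw [Real.sign_of_neg h]
    norm_num [mul_comm]
  · rw [Real.sign_of_pos h]
    norm_num [mul_comm]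

theorem abs_signedPow {x : ℝ} (hx : x ≠ 0) (z : ℝ) : |signedPow x z| = |x| ^ z := by
  rw [signedPow, abs_mul, abs_of_nonneg (Real.rpow_nonneg (abs_nonneg x) z)]
  rcases lt_or_gt_of_ne hx with h | h
  · rw [Real.sign_of_neg h]; simp
  · rw [Real.sign_of_pos h]; simp

theorem signedPow_ne_zero {x : ℝ} (hx : x ≠ 0) (z : ℝ) : signedPow x z ≠ 0 := by
  rw [signedPow_eq hx]
  exact mul_ne_zero hx (Real.rpow_pos_of_pos (abs_pos.2 hx) _).ne'

theorem signedPow_ne_one {x z : ℝ} (hx : x ≠ 0) (hx1 : x ≠ 1) (hz : 0 < z) :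
    signedPow x z ≠ 1 := by
  rcases lt_or_gt_of_ne hx with h | h
  · rw [signedPow, Real.sign_of_neg h]
    have := Real.rpow_nonneg (abs_nonneg x) z
    linarith
  · rw [signedPow, Real.sign_of_pos h, abs_of_pos h, one_mul]
    rcases lt_or_gt_of_ne hx1 with h1 | h1
    · exact (Real.rpow_lt_one h.le h1 hz).ne
    · exact (Real.one_lt_rpow h1 hz).ne'

theorem xOf_ne_zero {rs s : ℝ} (h0 : s ≠ 0) (hs : s ≠ rs) : xOf rs s ≠ 0 := by
  rw [xOf, Ne, sub_eq_zero, eq_comm, div_eq_one_iff_eq h0]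
  exact hs.symm

theorem xOf_ne_one {rs s : ℝ} (hrs : 0 < rs) (h0 : s ≠ 0) : xOf rs s ≠ 1 := by
  rw [xOf, Ne, sub_eq_self]
  exact div_ne_zero hrs.ne' h0

/-! ### Logarithmic derivatives of the special metric. -/

/-- `f` has the logarithmic derivative `l` at `s`. -/
def HasLogDerivAt (f : ℝ → ℝ) (l s : ℝ) : Prop := HasDerivAt f (f s * l) s

namespace HasLogDerivAt

variable {f g : ℝ → ℝ} {l m s : ℝ}

theorem mul (hf : HasLogDerivAt f l s) (hg : HasLogDerivAt g m s) :
    HasLogDerivAt (fun x => f x * g x) (l + m) s :=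
  (HasDerivAt.mul hf hg).congr_deriv (by ring)

theorem const_mul (c : ℝ) (hf : HasLogDerivAt f l s) : HasLogDerivAt (fun x => c * f x) l s :=
  (HasDerivAt.const_mul c hf).congr_deriv (by ring)

theorem inv (hf : HasLogDerivAt f l s) (h : f s ≠ 0) : HasLogDerivAt (fun x => (f x)⁻¹) (-l) s :=
  (HasDerivAt.inv hf h).congr_deriv (by field_simp)

theorem div (hf : HasLogDerivAt f l s) (hg : HasLogDerivAt g m s) (h : g s ≠ 0) :
    HasLogDerivAt (fun x => f x / g x) (l - m) s := by
  simpa only [div_eq_mul_inv, sub_eq_add_neg] using hf.mul (hg.inv h)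

theorem pow_succ (hf : HasLogDerivAt f l s) (n : ℕ) :
    HasLogDerivAt (fun x => f x ^ (n + 1)) ((n + 1) * l) s :=
  (HasDerivAt.pow hf (n + 1)).congr_deriv (by push_cast; ring)

theorem neg (hf : HasLogDerivAt f l s) : HasLogDerivAt (fun x => -f x) l s :=
  (HasDerivAt.neg hf).congr_deriv (by ring)

theorem abs_rpow (hf : HasLogDerivAt f l s) (h : f s ≠ 0) (p : ℝ) :
    HasLogDerivAt (fun x => |f x| ^ p) (p * l) s := by
  have key : ∀ y, y ≠ 0 → |y| ^ p = Real.exp (Real.log y * p) := fun y hy => by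
    rw [Real.rpow_def_of_pos (abs_pos.2 hy), Real.log_abs]
  have h1 : HasDerivAt (fun x => Real.exp (Real.log (f x) * p)) _ s :=
    ((HasDerivAt.log hf h).mul_const p).exp
  have h2 : (fun x => |f x| ^ p) =ᶠ[𝓝 s] fun x => Real.exp (Real.log (f x) * p) := by
    filter_upwards [hf.continuousAt.eventually_ne h] with x hx using key _ hx
  refine (h1.congr_of_eventuallyEq h2).congr_deriv ?_
  simp only [key _ h]
  field_simp

theorem signedPow (hf : HasLogDerivAt f l s) (h : f s ≠ 0) (z : ℝ) :
    HasLogDerivAt (fun x => signedPow (f x) z) (z * l) s := by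
  have h1 := hf.mul (hf.abs_rpow h (z - 1))
  have h2 : (fun x => _root_.signedPow (f x) z) =ᶠ[𝓝 s] fun x => f x * |f x| ^ (z - 1) := by
    filter_upwards [hf.continuousAt.eventually_ne h] with x hx using signedPow_eq hx z
  refine (HasDerivAt.congr_of_eventuallyEq h1 h2).congr_deriv ?_
  simp only [signedPow_eq h]
  ring

end HasLogDerivAt

theorem hasLogDerivAt_xOf {rs s : ℝ} (h0 : s ≠ 0) (hs : s ≠ rs) :
    HasLogDerivAt (xOf rs) (rs / (s * (s - rs))) s := by
  have h : HasDerivAt (xOf rs) (-(rs * -(s ^ 2)⁻¹)) s :=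
    ((hasDerivAt_inv h0).const_mul rs).const_sub 1
  refine h.congr_deriv ?_
  have := sub_ne_zero.2 hs
  rw [xOf]
  field_simp

/-- The logarithmic derivative of `arealRadius` divided by that of `xOf`. -/
def arealExponent (z S : ℝ) : ℝ := (z - 1) / 2 + z * (S / (1 - S))

theorem hasLogDerivAt_arealRadius {rs s : ℝ} (k : ℝ) (hrs : 0 < rs) (h0 : s ≠ 0) (hs : s ≠ rs) :
    HasLogDerivAt (arealRadius rs k)
      (arealExponent (zeta k) (signedPow (xOf rs s) (zeta k)) * (rs / (s * (s - rs)))) s := by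
  have hx := xOf_ne_zero h0 hs
  have hS : 1 - signedPow (xOf rs s) (zeta k) ≠ 0 :=
    sub_ne_zero.2 (signedPow_ne_one hx (xOf_ne_one hrs h0) (zeta_pos k)).symm
  have hX := hasLogDerivAt_xOf h0 hs
  have h1 : HasLogDerivAt (fun x => 1 - signedPow (xOf rs x) (zeta k))
      (-(zeta k * (signedPow (xOf rs s) (zeta k) / (1 - signedPow (xOf rs s) (zeta k)))
        * (rs / (s * (s - rs))))) s :=
    (HasDerivAt.const_sub 1 (hX.signedPow hx (zeta k))).congr_deriv (by field_simp)
  -- The exponent 1 turns the logarithmic derivative of `1 - S` into that of `|1 - S|`.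
  have h2 := h1.abs_rpow hS 1
  simp only [Real.rpow_one] at h2
  have h3 := ((hX.abs_rpow hx ((zeta k - 1) / 2)).const_mul (zeta k * rs)).div h2
    (abs_ne_zero.2 hS)
  refine HasDerivAt.congr_deriv h3 ?_
  rw [arealExponent, arealRadius]
  ring

theorem arealRadius_ne_zero {rs s : ℝ} (k : ℝ) (hrs : 0 < rs) (h0 : s ≠ 0) (hs : s ≠ rs) :
    arealRadius rs k s ≠ 0 := by
  have hx := xOf_ne_zero h0 hs
  have hS : 1 - signedPow (xOf rs s) (zeta k) ≠ 0 :=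
    sub_ne_zero.2 (signedPow_ne_one hx (xOf_ne_one hrs h0) (zeta_pos k)).symm
  exact div_ne_zero (mul_ne_zero (mul_ne_zero (zeta_pos k).ne' hrs.ne')
    (Real.rpow_pos_of_pos (abs_pos.2 hx) _).ne') (abs_ne_zero.2 hS)

theorem specialMetric_eq (rs k : ℝ) : specialMetric rs k = sphericalMetric
    (fun s => |xOf rs s| ^ k * -(xOf rs s))
    (fun s => |xOf rs s| ^ k * ((xOf rs s)⁻¹ * (arealRadius rs k s ^ 4 / s ^ 4)))
    (fun s => |xOf rs s| ^ k * arealRadius rs k s ^ 2) := by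
  funext p
  rw [specialMetric, sphericalMetric, ← Matrix.diagonal_smul]
  congr 1
  funext i
  fin_cases i <;> simp [mul_assoc]

theorem hasLogDerivs_specialMetric {rs : ℝ} (k : ℝ) (hrs : 0 < rs) :
    HasLogDerivs {s | s ≠ 0 ∧ s ≠ rs}
      (fun s => |xOf rs s| ^ k * -(xOf rs s))
      (fun s => |xOf rs s| ^ k * ((xOf rs s)⁻¹ * (arealRadius rs k s ^ 4 / s ^ 4)))
      (fun s => |xOf rs s| ^ k * arealRadius rs k s ^ 2)
      (fun s => (k + 1) * (rs / (s * (s - rs))))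
      (fun s => (k - 1 + 4 * arealExponent (zeta k) (signedPow (xOf rs s) (zeta k)))
        * (rs / (s * (s - rs))) - 4 / s)
      (fun s => (k + 2 * arealExponent (zeta k) (signedPow (xOf rs s) (zeta k)))
        * (rs / (s * (s - rs)))) where
  isOpen := isOpen_ne.inter isOpen_ne
  a_ne s hs := by
    have hx := xOf_ne_zero hs.1 hs.2
    exact mul_ne_zero (Real.rpow_pos_of_pos (abs_pos.2 hx) _).ne' (neg_ne_zero.2 hx)
  b_ne s hs := by
    have hx := xOf_ne_zero hs.1 hs.2
    exact mul_ne_zero (Real.rpow_pos_of_pos (abs_pos.2 hx) _).ne' (mul_ne_zero (inv_ne_zero hx)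
      (div_ne_zero (pow_ne_zero 4 (arealRadius_ne_zero k hrs hs.1 hs.2)) (pow_ne_zero 4 hs.1)))
  c_ne s hs := by
    have hx := xOf_ne_zero hs.1 hs.2
    exact mul_ne_zero (Real.rpow_pos_of_pos (abs_pos.2 hx) _).ne'
      (pow_ne_zero 2 (arealRadius_ne_zero k hrs hs.1 hs.2))
  a_deriv s hs := by
    have hX := hasLogDerivAt_xOf hs.1 hs.2
    exact HasDerivAt.congr_deriv ((hX.abs_rpow (xOf_ne_zero hs.1 hs.2) k).mul hX.neg) (by ring)
  b_deriv s hs := by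
    have hx := xOf_ne_zero hs.1 hs.2
    have hX := hasLogDerivAt_xOf hs.1 hs.2
    have hid : HasLogDerivAt (fun s : ℝ => s) (1 / s) s :=
      (hasDerivAt_id s).congr_deriv (by have := hs.1; field_simp)
    exact HasDerivAt.congr_deriv ((hX.abs_rpow hx k).mul ((hX.inv hx).mul
      (((hasLogDerivAt_arealRadius k hrs hs.1 hs.2).pow_succ 3).div (hid.pow_succ 3)
        (pow_ne_zero 4 hs.1)))) (by push_cast; ring)
  c_deriv s hs := by
    have hX := hasLogDerivAt_xOf hs.1 hs.2
    exact HasDerivAt.congr_deriv ((hX.abs_rpow (xOf_ne_zero hs.1 hs.2) k).mul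
      ((hasLogDerivAt_arealRadius k hrs hs.1 hs.2).pow_succ 1)) (by push_cast; ring)

theorem hasDerivAt_log_deriv_xOf {rs s : ℝ} (h0 : s ≠ 0) (hs : s ≠ rs) :
    HasDerivAt (fun s => rs / (s * (s - rs)))
      (-(rs / (s * (s - rs))) ^ 2 - 2 / s * (rs / (s * (s - rs)))) s := by
  have h := sub_ne_zero.2 hs
  refine ((hasDerivAt_const s rs).div ((hasDerivAt_id s).mul ((hasDerivAt_id s).sub_const rs))
    (mul_ne_zero h0 h)).congr_deriv ?_
  simp only [id, Pi.mul_apply]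
  field_simp
  ring

theorem hasDerivAt_arealExponent {rs s : ℝ} (k : ℝ) (hrs : 0 < rs) (h0 : s ≠ 0) (hs : s ≠ rs) :
    HasDerivAt (fun s => arealExponent (zeta k) (signedPow (xOf rs s) (zeta k)))
      (zeta k ^ 2 * signedPow (xOf rs s) (zeta k) / (1 - signedPow (xOf rs s) (zeta k)) ^ 2
        * (rs / (s * (s - rs)))) s := by
  have hx := xOf_ne_zero h0 hs
  have hS : 1 - signedPow (xOf rs s) (zeta k) ≠ 0 :=
    sub_ne_zero.2 (signedPow_ne_one hx (xOf_ne_one hrs h0) (zeta_pos k)).symm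
  have h1 : HasDerivAt _ _ s := (hasLogDerivAt_xOf h0 hs).signedPow hx (zeta k)
  refine (((h1.div (h1.const_sub 1) hS).const_mul (zeta k)).const_add
    ((zeta k - 1) / 2)).congr_deriv ?_
  field_simp
  ring

/-! ### The closed form of the Kretschmann scalar. -/

/-- The curvature invariant of the special metric up to a common factor, as a sum of squares. -/
theorem sum_sq_eq_closed (k S : ℝ) :
    (k + 1) ^ 2 * (zeta k * (1 + S) - (1 - S)) ^ 2
      + (k + 1) ^ 2 * (zeta k * (1 + S) + (k - 1) * (1 - S)) ^ 2 / 2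
      + (zeta k ^ 2 * (1 - S) + (k - 1) * zeta k * (1 + S)) ^ 2 / 2
      + ((zeta k ^ 2 + (k - 1) ^ 2) * (1 - S) + 2 * (k - 1) * zeta k * (1 + S)) ^ 2 / 4
    = 2 * (4 * k ^ 2 * (k + 1) * S + zeta k * polyA k * (1 - S ^ 2) + polyB k * (1 + S ^ 2)) := by
  have h2 := sq_zeta k
  have h3 : zeta k ^ 3 = zeta k * (1 + 3 * k ^ 2) := by rw [← h2]; ring
  have h4 : zeta k ^ 4 = (1 + 3 * k ^ 2) ^ 2 := by rw [← h2]; ring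
  rw [polyA, polyB]
  -- The three multipliers are the coefficients of `ζ²`, `ζ³` and `ζ⁴` in the expanded left side.
  linear_combination (3 * (k ^ 2 + 1) * (1 + S) ^ 2 + (k - 1) ^ 2 / 2 * (1 - S) ^ 2) * h2
    + 2 * (k - 1) * (1 + S) * (1 - S) * h3 + 3 / 4 * (1 - S) ^ 2 * h4

/-- Here `X = x`, `P = |x|^k`, `L` is the logarithmic derivative of `x` and `q * L` that of the
areal radius. Since `L' = -L² - 2L/s`, the term `-4/s` of `v` cancels the explicit `1/s` terms. All
curvatures are then multiples of `L²/b` or `1/c`, in which `s` drops out. -/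
theorem sphericalKretschmann_eq {rs s k z P S X : ℝ} (hrs : rs ≠ 0) (h0 : s ≠ 0) (hP : P ≠ 0)
    (hX : X ≠ 0) (hS0 : S ≠ 0) (hS : 1 - S ≠ 0) (hz : z ≠ 0) {b c L q v : ℝ}
    (hL : L = rs / (s ^ 2 * X)) (hq : q = (z - 1) / 2 + z * (S / (1 - S)))
    (hv : v = (k - 1 + 4 * q) * L - 4 / s)
    (hb : b = P * (X⁻¹ * ((z ^ 2 * rs ^ 2 * (S / X) / (1 - S) ^ 2) ^ 2 / s ^ 4)))
    (hc : c = P * (z ^ 2 * rs ^ 2 * (S / X) / (1 - S) ^ 2)) :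
    4 * ((2 * ((k + 1) * (-L ^ 2 - 2 / s * L)) + ((k + 1) * L) ^ 2 - (k + 1) * L * v) / (4 * b)) ^ 2
        + 8 * ((k + 1) * L * ((k + 2 * q) * L) / (4 * b)) ^ 2
        + 8 * ((2 * (2 * (z ^ 2 * S / (1 - S) ^ 2 * L) * L + (k + 2 * q) * (-L ^ 2 - 2 / s * L))
          + ((k + 2 * q) * L) ^ 2 - (k + 2 * q) * L * v) / (4 * b)) ^ 2
        + 4 * (1 / c - ((k + 2 * q) * L) ^ 2 / (4 * b)) ^ 2 =
      (X / (P * S ^ 2 * rs ^ 2)) ^ 2 * (1 - S) ^ 6 / z ^ 8 *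
        ((k + 1) ^ 2 * (z * (1 + S) - (1 - S)) ^ 2
        + (k + 1) ^ 2 * (z * (1 + S) + (k - 1) * (1 - S)) ^ 2 / 2
        + (z ^ 2 * (1 - S) + (k - 1) * z * (1 + S)) ^ 2 / 2
        + ((z ^ 2 + (k - 1) ^ 2) * (1 - S) + 2 * (k - 1) * z * (1 + S)) ^ 2 / 4) := by
  have hq' : q = (z * (1 + S) - (1 - S)) / (2 * (1 - S)) := by
    rw [hq]
    field_simp
    ring
  have hbb : b ≠ 0 := by
    rw [hb]
    positivity
  have hLb : L ^ 2 / b = X / (P * S ^ 2 * rs ^ 2) * (1 - S) ^ 4 / z ^ 4 := by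
    rw [hL, hb]
    field_simp
  have hcb : 1 / c = X / (P * S ^ 2 * rs ^ 2) * (S * (1 - S) ^ 2 / z ^ 2) := by
    rw [hc]
    field_simp
  have e1 : (2 * ((k + 1) * (-L ^ 2 - 2 / s * L)) + ((k + 1) * L) ^ 2 - (k + 1) * L * v) / (4 * b)
      = L ^ 2 / b * (-(k + 1) * q) := by
    rw [hv]
    field_simp
    ring
  have e2 : (k + 1) * L * ((k + 2 * q) * L) / (4 * b) = L ^ 2 / b * ((k + 1) * (k + 2 * q) / 4) := by
    field_simp
  have e3 : (2 * (2 * (z ^ 2 * S / (1 - S) ^ 2 * L) * L + (k + 2 * q) * (-L ^ 2 - 2 / s * L))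
        + ((k + 2 * q) * L) ^ 2 - (k + 2 * q) * L * v) / (4 * b)
      = L ^ 2 / b * ((4 * (z ^ 2 * S / (1 - S) ^ 2) - (k + 2 * q) * (1 + 2 * q)) / 4) := by
    rw [hv]
    field_simp
    ring
  have e4 : ((k + 2 * q) * L) ^ 2 / (4 * b) = L ^ 2 / b * ((k + 2 * q) ^ 2 / 4) := by
    field_simp
  rw [e1, e2, e3, e4, hLb, hcb, hq']
  generalize X / (P * S ^ 2 * rs ^ 2) = N
  -- Clearing the denominators of `q` takes one factor `1 - S` out of the curvatures, so that they
  -- share `N (1 - S)³ / z⁴`; its square gives the sixth power.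
  have f1 : N * (1 - S) ^ 4 / z ^ 4 * (-(k + 1) * ((z * (1 + S) - (1 - S)) / (2 * (1 - S)))) =
      -(N * (1 - S) ^ 3 / z ^ 4) * ((k + 1) * (z * (1 + S) - (1 - S)) / 2) := by
    field_simp
  have f2 : N * (1 - S) ^ 4 / z ^ 4 *
      ((k + 1) * (k + 2 * ((z * (1 + S) - (1 - S)) / (2 * (1 - S)))) / 4) =
      N * (1 - S) ^ 3 / z ^ 4 * ((k + 1) * (z * (1 + S) + (k - 1) * (1 - S)) / 4) := by
    field_simp
    ring
  have f3 : N * (1 - S) ^ 4 / z ^ 4 * ((4 * (z ^ 2 * S / (1 - S) ^ 2)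
      - (k + 2 * ((z * (1 + S) - (1 - S)) / (2 * (1 - S))))
        * (1 + 2 * ((z * (1 + S) - (1 - S)) / (2 * (1 - S))))) / 4) =
      -(N * (1 - S) ^ 3 / z ^ 4) * ((z ^ 2 * (1 - S) + (k - 1) * z * (1 + S)) / 4) := by
    field_simp
    ring
  have f4 : N * (S * (1 - S) ^ 2 / z ^ 2) - N * (1 - S) ^ 4 / z ^ 4 *
      ((k + 2 * ((z * (1 + S) - (1 - S)) / (2 * (1 - S)))) ^ 2 / 4) =
      -(N * (1 - S) ^ 3 / z ^ 4) *
        (((z ^ 2 + (k - 1) ^ 2) * (1 - S) + 2 * (k - 1) * z * (1 + S)) / 4) := by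
    field_simp
    ring
  rw [f1, f2, f3, f4]
  ring

theorem kretschmann_specialMetric {rs : ℝ} (k : ℝ) (hrs : 0 < rs) {p : Chart} (h0 : p 1 ≠ 0)
    (hs : p 1 ≠ rs) (hsin : Real.sin (p 2) ≠ 0) :
    kretschmann (specialMetric rs k) p = kretschmannClosed rs k (xOf rs (p 1)) := by
  have hL := hasDerivAt_log_deriv_xOf h0 hs
  have hq := hasDerivAt_arealExponent k hrs h0 hs
  have hv := ((((hq.const_mul 4).const_add (k - 1)).mul hL).sub
    ((hasDerivAt_const (p 1) (4 : ℝ)).div (hasDerivAt_id (p 1)) h0))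
  rw [specialMetric_eq, kretschmann_sphericalMetric (hasLogDerivs_specialMetric k hrs) ⟨h0, hs⟩
    hsin (hL.const_mul (k + 1)) hv (((hq.const_mul 2).const_add k).mul hL)]
  have hx := xOf_ne_zero h0 hs
  have hX1 := xOf_ne_one hrs h0
  have hS := sub_ne_zero.2 (signedPow_ne_one hx hX1 (zeta_pos k)).symm
  have hY := abs_pos.2 hx
  have hlog : rs / (p 1 * (p 1 - rs)) = rs / (p 1 ^ 2 * xOf rs (p 1)) := by
    have := sub_ne_zero.2 hs
    rw [xOf]
    field_simp
  have hz := (zeta_pos k).ne'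
  have hr2 : arealRadius rs k (p 1) ^ 2 = zeta k ^ 2 * rs ^ 2
      * |xOf rs (p 1)| ^ (zeta k - 1) / (1 - signedPow (xOf rs (p 1)) (zeta k)) ^ 2 := by
    rw [arealRadius, div_pow, sq_abs, mul_pow, mul_pow, ← Real.rpow_mul_natCast hY.le]
    norm_num
  have hr4 : arealRadius rs k (p 1) ^ 4 = (arealRadius rs k (p 1) ^ 2) ^ 2 := by ring
  -- Because `S = x |x|^(ζ-1)`, this base is `X / (P S²)`; squaring it removes the sign of `x`.
  have hpow : |xOf rs (p 1)| ^ (2 - 4 * zeta k - 2 * k) =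
      ((xOf rs (p 1)) * |xOf rs (p 1)| ^ k * (|xOf rs (p 1)| ^ (zeta k - 1)) ^ 2)⁻¹ ^ 2 := by
    rw [inv_pow, mul_pow, mul_pow, ← sq_abs (xOf rs (p 1)), ← pow_mul,
      ← Real.rpow_mul_natCast hY.le, ← Real.rpow_mul_natCast hY.le, ← Real.rpow_natCast,
      ← Real.rpow_add hY, ← Real.rpow_add hY, ← Real.rpow_neg hY.le]
    congr 1
    push_cast
    ring
  have hsum := sum_sq_eq_closed k (signedPow (xOf rs (p 1)) (zeta k))
  rw [kretschmannClosed, ← sq_signedPow hx, hpow]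
  have hSx := signedPow_eq hx (zeta k)
  have hP := (Real.rpow_pos_of_pos hY k).ne'
  have hQ := (Real.rpow_pos_of_pos hY (zeta k - 1)).ne'
  simp only [hlog, hr4, hr2, arealExponent]
  generalize signedPow (xOf rs (p 1)) (zeta k) = S at *
  generalize |xOf rs (p 1)| ^ k = P at *
  generalize |xOf rs (p 1)| ^ (zeta k - 1) = Q at *
  generalize xOf rs (p 1) = X at *
  generalize zeta k = z at *
  have hS0 : S ≠ 0 := hSx ▸ mul_ne_zero hx hQ
  have hQS : Q = S / X := by
    rw [hSx]
    field_simp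
  subst hQS
  rw [sphericalKretschmann_eq (v := (k - 1 + 4 * ((z - 1) / 2 + z * (S / (1 - S))))
    * (rs / (p 1 ^ 2 * X)) - 4 / p 1) hrs.ne' h0 hP hx hS0 hS hz rfl rfl rfl rfl rfl, hsum]
  field_simp

/-! ### Positivity of the quadratic in the signed power. -/

theorem polyB_pos (k : ℝ) : 0 < polyB k := by
  rw [polyB]
  nlinarith [sq_nonneg (k * (k - 1)), sq_nonneg (k ^ 2), sq_nonneg k]

/-- This is the product of the leading and constant coefficients of the quadratic in `S`; the factor
`k²(k+1)²` isolates the exceptional parameters. -/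
theorem polyB_sq_sub (k : ℝ) : polyB k ^ 2 - (zeta k * polyA k) ^ 2 =
    k ^ 2 * (k + 1) ^ 2 * (3 + 6 * k + 24 * k ^ 2 + 18 * k ^ 3 + 33 * k ^ 4) := by
  rw [mul_pow, sq_zeta, polyA, polyB]
  ring

/-- The coefficient 20 is the 24 of `polyB_sq_sub` less 4: the discriminant also contains the square
of the linear coefficient `4k²(k+1)`. -/
theorem quartic_pos (k : ℝ) : 0 < 3 + 6 * k + 20 * k ^ 2 + 18 * k ^ 3 + 33 * k ^ 4 := by
  nlinarith [sq_nonneg (k * (3 * k + 1)), sq_nonneg (k + 1), sq_nonneg (k ^ 2), sq_nonneg k]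

theorem abs_zeta_mul_polyA_lt {k : ℝ} (h0 : k ≠ 0) (h1 : k ≠ -1) :
    |zeta k * polyA k| < polyB k := by
  refine abs_lt_of_sq_lt_sq ?_ (polyB_pos k).le
  have h2 : k + 1 ≠ 0 := fun h => h1 (eq_neg_of_add_eq_zero_left h)
  have h3 := quartic_pos k
  have h4 : 0 < k ^ 2 * (k + 1) ^ 2 * (3 + 6 * k + 24 * k ^ 2 + 18 * k ^ 3 + 33 * k ^ 4) := by
    have : 0 < 3 + 6 * k + 24 * k ^ 2 + 18 * k ^ 3 + 33 * k ^ 4 := by nlinarith [sq_nonneg k]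
    positivity
  linarith [polyB_sq_sub k]

theorem polyB_add_pos {k : ℝ} (h0 : k ≠ 0) (h1 : k ≠ -1) : 0 < polyB k + zeta k * polyA k := by
  linarith [(abs_lt.1 (abs_zeta_mul_polyA_lt h0 h1)).1]

theorem zeta_zero : zeta 0 = 1 := by norm_num [zeta]

theorem zeta_neg_one : zeta (-1) = 2 := by
  rw [zeta, show (1 + 3 * (-1) ^ 2 : ℝ) = 2 ^ 2 by norm_num, Real.sqrt_sq zero_le_two]

theorem polyB_sub_pos (k : ℝ) : 0 < polyB k - zeta k * polyA k := by
  by_cases h0 : k = 0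
  · subst h0
    norm_num [zeta_zero, polyA, polyB]
  by_cases h1 : k = -1
  · subst h1
    norm_num [zeta_neg_one, polyA, polyB]
  linarith [(abs_lt.1 (abs_zeta_mul_polyA_lt h0 h1)).2]

theorem closed_factor_pos {k S : ℝ} (hS : S ≠ 0) : 0 < 4 * k ^ 2 * (k + 1) * S
    + zeta k * polyA k * (1 - S ^ 2) + polyB k * (1 + S ^ 2) := by
  have hc := polyB_sub_pos k
  have hd := polyB_sq_sub k
  by_cases h : k = 0 ∨ k = -1
  · have hS2 : 0 < S ^ 2 := by positivity
    rcases h with rfl | rfl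
    · norm_num [zeta_zero, polyA, polyB]
      linarith
    · norm_num [zeta_neg_one, polyA, polyB]
      linarith
  · rw [not_or] at h
    have h2 : k + 1 ≠ 0 := fun h1 => h.2 (eq_neg_of_add_eq_zero_left h1)
    have hk := h.1
    have h3 := quartic_pos k
    have h4 : 0 < k ^ 2 * (k + 1) ^ 2 * (3 + 6 * k + 20 * k ^ 2 + 18 * k ^ 3 + 33 * k ^ 4) := by
      positivity
    -- Completing the square: four times the leading coefficient times the quadratic is a square
    -- plus minus the discriminant.
    refine pos_of_mul_pos_right (a := 4 * (polyB k - zeta k * polyA k)) ?_ (by positivity)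
    have h5 := sq_nonneg (2 * (polyB k - zeta k * polyA k) * S + 4 * k ^ 2 * (k + 1))
    nlinarith [h4, h5, hd]

theorem kretschmannClosed_eq {x : ℝ} (rs k : ℝ) (hx : x ≠ 0) : kretschmannClosed rs k x =
    2 / (zeta k ^ 8 * rs ^ 4) * |x| ^ (2 * (1 - 2 * zeta k - k)) *
      ((1 - signedPow x (zeta k)) ^ 6 * (4 * k ^ 2 * (k + 1) * signedPow x (zeta k)
        + zeta k * polyA k * (1 - signedPow x (zeta k) ^ 2)
        + polyB k * (1 + signedPow x (zeta k) ^ 2))) := by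
  rw [kretschmannClosed, sq_signedPow hx,
    show 2 - 4 * zeta k - 2 * k = 2 * (1 - 2 * zeta k - k) by ring]
  ring

theorem kretschmannClosed_pos {rs k x : ℝ} (hrs : 0 < rs) (hx : x ≠ 0) (hx1 : x ≠ 1) :
    0 < kretschmannClosed rs k x := by
  have hS := sub_ne_zero.2 (signedPow_ne_one hx hx1 (zeta_pos k)).symm
  have hF := closed_factor_pos (k := k) (signedPow_ne_zero hx (zeta k))
  have hz := zeta_pos k
  rw [kretschmannClosed_eq rs k hx]
  have := abs_pos.2 hx
  have h6 : 0 < (1 - signedPow x (zeta k)) ^ 6 := by positivity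
  positivity

/-- This fixes the signs of both exponents, `2ζ - k + 1` at the origin and `1 - 2ζ - k` at `ρ =
r_s`. -/
theorem one_sub_abs_lt_two_zeta (k : ℝ) : 1 + |k| < 2 * zeta k := by
  refine lt_of_pow_lt_pow_left₀ 2 (by have := zeta_pos k; positivity) ?_
  rw [mul_pow, sq_zeta]
  nlinarith [sq_abs k, sq_nonneg (|k| - 1)]

/-! ### Asymptotics at the origin and at `ρ = r_s`. -/

theorem tendsto_signedPow_xOf {rs z : ℝ} (hrs : 0 < rs) (hz : 0 < z) :
    Tendsto (fun s => signedPow (xOf rs s) z) (𝓝[≠] rs) (𝓝 0) := by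
  have hx : Tendsto (fun s => |xOf rs s|) (𝓝[≠] rs) (𝓝 0) := by
    have h : ContinuousAt (fun s => |1 - rs / s|) rs := by fun_prop (disch := exact hrs.ne')
    simpa [xOf, hrs.ne'] using h.tendsto.mono_left nhdsWithin_le_nhds
  have h := hx.rpow_const (p := z) (Or.inr hz.le)
  rw [Real.zero_rpow hz.ne'] at h
  refine squeeze_zero_norm' ?_ h
  filter_upwards [self_mem_nhdsWithin, (eventually_ne_nhds hrs.ne').filter_mono nhdsWithin_le_nhds]
    with s hs h0
  rw [Real.norm_eq_abs, abs_signedPow (xOf_ne_zero h0 hs)]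

theorem tendsto_inv_signedPow_xOf {rs z : ℝ} (hrs : 0 < rs) (hz : 0 < z) :
    Tendsto (fun s => (signedPow (xOf rs s) z)⁻¹) (𝓝[≠] 0) (𝓝 0) := by
  have hx : Tendsto (fun s => |s / (s - rs)|) (𝓝[≠] 0) (𝓝 0) := by
    have h : ContinuousAt (fun s => |s / (s - rs)|) 0 := by
      fun_prop (disch := simpa using hrs.ne')
    simpa using h.tendsto.mono_left nhdsWithin_le_nhds
  have h := hx.rpow_const (p := z) (Or.inr hz.le)
  rw [Real.zero_rpow hz.ne'] at h
  refine squeeze_zero_norm' ?_ h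
  filter_upwards [self_mem_nhdsWithin, (eventually_ne_nhds hrs.ne).filter_mono nhdsWithin_le_nhds]
    with s h0 hs
  rw [norm_inv, Real.norm_eq_abs, abs_signedPow (xOf_ne_zero h0 hs),
    ← Real.inv_rpow (abs_nonneg _), ← abs_inv]
  have h1 := sub_ne_zero.2 hs
  have h2 : (xOf rs s)⁻¹ = s / (s - rs) := by
    have h0' : s ≠ 0 := h0
    rw [xOf]
    field_simp
  rw [h2]

theorem kretschmannClosed_isEquivalent_zero {rs : ℝ} (k : ℝ) (hrs : 0 < rs) :
    (fun s => kretschmannClosed rs k (xOf rs s)) ~[𝓝[≠] 0]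
      fun s => 2 / (zeta k ^ 8 * rs ^ 4) * (polyB k - zeta k * polyA k)
        * |rs / s| ^ (2 * (2 * zeta k - k + 1)) := by
  have hc := polyB_sub_pos k
  rw [isEquivalent_iff_exists_eq_mul]
  -- The closed form has degree 8 in `S`; taking out `S⁸` leaves a polynomial in `1/S`, and `x =
  -- (rs/s)(s/rs - 1)` gives the first factor.
  refine ⟨fun s => |s / rs - 1| ^ (2 * (2 * zeta k - k + 1)) *
    (((signedPow (xOf rs s) (zeta k))⁻¹ - 1) ^ 6 *
      (4 * k ^ 2 * (k + 1) * (signedPow (xOf rs s) (zeta k))⁻¹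
        + zeta k * polyA k * ((signedPow (xOf rs s) (zeta k))⁻¹ ^ 2 - 1)
        + polyB k * ((signedPow (xOf rs s) (zeta k))⁻¹ ^ 2 + 1))
      / (polyB k - zeta k * polyA k)), ?_, ?_⟩
  · have hS := tendsto_inv_signedPow_xOf hrs (zeta_pos k)
    have h1 : Tendsto (fun s => |s / rs - 1| ^ (2 * (2 * zeta k - k + 1))) (𝓝[≠] 0) (𝓝 1) := by
      have h : ContinuousAt (fun s => |s / rs - 1| ^ (2 * (2 * zeta k - k + 1))) 0 := by
        refine ContinuousAt.rpow_const ?_ (Or.inl (by simp))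
        fun_prop
      simpa using h.tendsto.mono_left nhdsWithin_le_nhds
    have h2 : Continuous fun y : ℝ => (y - 1) ^ 6 * (4 * k ^ 2 * (k + 1) * y
        + zeta k * polyA k * (y ^ 2 - 1) + polyB k * (y ^ 2 + 1))
        / (polyB k - zeta k * polyA k) := by fun_prop
    have h3 := h1.mul ((h2.tendsto 0).comp hS)
    refine h3.mono_right (le_of_eq (congrArg 𝓝 ?_))
    norm_num
    rw [neg_add_eq_sub, div_self hc.ne']
  · filter_upwards [self_mem_nhdsWithin,
      (eventually_ne_nhds hrs.ne).filter_mono nhdsWithin_le_nhds] with s h0 hs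
    have hx := xOf_ne_zero h0 hs
    have hY := abs_pos.2 hx
    have hS := signedPow_ne_zero hx (zeta k)
    have h0' : s ≠ 0 := h0
    have hxs : xOf rs s = rs / s * (s / rs - 1) := by
      rw [xOf]
      field_simp
    -- The even power `S⁸` equals `|x|^(8ζ)`, and `2(1 - 2ζ - k) + 8ζ = 2(2ζ - k + 1)`.
    have hm : |s / rs - 1| ^ (2 * (2 * zeta k - k + 1)) * |rs / s| ^ (2 * (2 * zeta k - k + 1)) =
        |xOf rs s| ^ (2 * (1 - 2 * zeta k - k)) * signedPow (xOf rs s) (zeta k) ^ 8 := by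
      rw [← Real.mul_rpow (abs_nonneg _) (abs_nonneg _), ← abs_mul, mul_comm (s / rs - 1), ← hxs,
        show signedPow (xOf rs s) (zeta k) ^ 8 = (signedPow (xOf rs s) (zeta k) ^ 2) ^ 4 by ring,
        sq_signedPow hx, ← Real.rpow_mul_natCast hY.le, ← Real.rpow_add hY]
      congr 1
      push_cast
      ring
    simp only [Pi.mul_apply]
    rw [kretschmannClosed_eq rs k hx]
    calc _ = 2 / (zeta k ^ 8 * rs ^ 4) * (|xOf rs s| ^ (2 * (1 - 2 * zeta k - k))
          * signedPow (xOf rs s) (zeta k) ^ 8) *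
        (((signedPow (xOf rs s) (zeta k))⁻¹ - 1) ^ 6 *
          (4 * k ^ 2 * (k + 1) * (signedPow (xOf rs s) (zeta k))⁻¹
        + zeta k * polyA k * ((signedPow (xOf rs s) (zeta k))⁻¹ ^ 2 - 1)
        + polyB k * ((signedPow (xOf rs s) (zeta k))⁻¹ ^ 2 + 1))) := by
          have hz := (zeta_pos k).ne'
          field_simp
      _ = _ := by
          rw [← hm]
          have hz := (zeta_pos k).ne'
          have hc' := hc.ne'
          field_simp

theorem kretschmannClosed_isEquivalent_horizon {rs k : ℝ} (hrs : 0 < rs) (h0 : k ≠ 0)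
    (h1 : k ≠ -1) : (fun s => kretschmannClosed rs k (xOf rs s)) ~[𝓝[≠] rs]
      fun s => 2 / (zeta k ^ 8 * rs ^ 4) * (polyB k + zeta k * polyA k)
        * |xOf rs s| ^ (2 * (1 - 2 * zeta k - k)) := by
  have hc := (polyB_add_pos h0 h1).ne'
  rw [isEquivalent_iff_exists_eq_mul]
  refine ⟨fun s => (1 - signedPow (xOf rs s) (zeta k)) ^ 6 *
      (4 * k ^ 2 * (k + 1) * signedPow (xOf rs s) (zeta k)
        + zeta k * polyA k * (1 - signedPow (xOf rs s) (zeta k) ^ 2)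
        + polyB k * (1 + signedPow (xOf rs s) (zeta k) ^ 2))
      / (polyB k + zeta k * polyA k), ?_, ?_⟩
  · have hS := tendsto_signedPow_xOf hrs (zeta_pos k)
    have h2 : Continuous fun y : ℝ => (1 - y) ^ 6 * (4 * k ^ 2 * (k + 1) * y
        + zeta k * polyA k * (1 - y ^ 2) + polyB k * (1 + y ^ 2))
        / (polyB k + zeta k * polyA k) := by fun_prop
    refine ((h2.tendsto 0).comp hS).mono_right (le_of_eq (congrArg 𝓝 ?_))
    norm_num
    rw [add_comm, div_self hc]
  · filter_upwards [self_mem_nhdsWithin,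
      (eventually_ne_nhds hrs.ne').filter_mono nhdsWithin_le_nhds] with s hs h0
    simp only [Pi.mul_apply]
    rw [kretschmannClosed_eq rs k (xOf_ne_zero h0 hs)]
    have hz := (zeta_pos k).ne'
    field_simp

/-- The hypotheses hold for `k = 0` and `k = -1`. By `ha` and `hb` the quadratic reduces to `2B S²`,
and by `he` the factor `S²` cancels the power of `|x|`, so only `(1 - S)⁶` still varies. -/
theorem tendsto_kretschmannClosed_horizon {rs k : ℝ} (hrs : 0 < rs)
    (ha : polyB k + zeta k * polyA k = 0) (hb : k ^ 2 * (k + 1) = 0) (he : 1 - zeta k - k = 0) :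
    Tendsto (fun s => kretschmannClosed rs k (xOf rs s)) (𝓝[≠] rs)
      (𝓝 (2 / (zeta k ^ 8 * rs ^ 4) * (2 * polyB k))) := by
  have hS := tendsto_signedPow_xOf hrs (zeta_pos k)
  have h2 : Continuous fun y : ℝ => 2 / (zeta k ^ 8 * rs ^ 4) * (2 * polyB k) * (1 - y) ^ 6 := by
    fun_prop
  have h3 := (h2.tendsto 0).comp hS
  rw [sub_zero, one_pow, mul_one] at h3
  refine h3.congr' ?_
  filter_upwards [self_mem_nhdsWithin,
      (eventually_ne_nhds hrs.ne').filter_mono nhdsWithin_le_nhds] with s hs h0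
  have hx := xOf_ne_zero h0 hs
  have hY := abs_pos.2 hx
  have hm : |xOf rs s| ^ (2 * (1 - 2 * zeta k - k)) * signedPow (xOf rs s) (zeta k) ^ 2 = 1 := by
    rw [sq_signedPow hx, ← Real.rpow_add hY,
      show 2 * (1 - 2 * zeta k - k) + 2 * zeta k = 0 by linear_combination 2 * he, Real.rpow_zero]
  rw [kretschmannClosed_eq rs k hx, Function.comp_apply]
  linear_combination (-(2 / (zeta k ^ 8 * rs ^ 4) * (2 * polyB k) *
      (1 - signedPow (xOf rs s) (zeta k)) ^ 6)) * hm
    - 2 / (zeta k ^ 8 * rs ^ 4) * |xOf rs s| ^ (2 * (1 - 2 * zeta k - k)) *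
      (1 - signedPow (xOf rs s) (zeta k)) ^ 6 * (4 * signedPow (xOf rs s) (zeta k) * hb
        + (1 - signedPow (xOf rs s) (zeta k) ^ 2) * ha)

theorem abs_xOf_rpow_isTheta {rs : ℝ} (hrs : 0 < rs) (e : ℝ) :
    (fun s => |xOf rs s| ^ e) =Θ[𝓝[≠] rs] fun s => |s - rs| ^ e := by
  have h : (fun s => |xOf rs s| ^ e) ~[𝓝[≠] rs] fun s => |rs|⁻¹ ^ e * |s - rs| ^ e := by
    rw [isEquivalent_iff_exists_eq_mul]
    refine ⟨fun s => |rs / s| ^ e, ?_, ?_⟩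
    · have h : ContinuousAt (fun s => |rs / s| ^ e) rs := by
        refine ContinuousAt.rpow_const ?_ (Or.inl (by simp [hrs.ne']))
        fun_prop (disch := exact hrs.ne')
      simpa [hrs.ne'] using h.tendsto.mono_left nhdsWithin_le_nhds
    · filter_upwards [(eventually_ne_nhds hrs.ne').filter_mono nhdsWithin_le_nhds] with s h0
      simp only [Pi.mul_apply]
      rw [← Real.mul_rpow (by positivity) (abs_nonneg _), ← Real.mul_rpow (abs_nonneg _)
        (by positivity), ← abs_inv, ← abs_mul, ← abs_mul, xOf]
      congr 2
      have := hrs.ne'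
      field_simp
  refine h.isTheta.trans ?_
  exact (isTheta_refl _ _).const_mul_left (by have := hrs.ne'; positivity)

theorem tendsto_abs_xOf_rpow {rs e : ℝ} (hrs : 0 < rs) (he : e < 0) :
    Tendsto (fun s => |xOf rs s| ^ e) (𝓝[≠] rs) atTop := by
  refine (tendsto_rpow_neg_nhdsGT_zero he).comp (tendsto_nhdsWithin_iff.2 ⟨?_, ?_⟩)
  · have h : ContinuousAt (fun s => |1 - rs / s|) rs := by fun_prop (disch := exact hrs.ne')
    simpa [xOf, hrs.ne'] using h.tendsto.mono_left nhdsWithin_le_nhds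
  · filter_upwards [self_mem_nhdsWithin,
      (eventually_ne_nhds hrs.ne').filter_mono nhdsWithin_le_nhds] with s hs h0
    exact abs_pos.2 (xOf_ne_zero h0 hs)

theorem tendsto_abs_div_rpow {rs e : ℝ} (hrs : 0 < rs) (he : 0 < e) :
    Tendsto (fun s => |rs / s| ^ e) (𝓝[≠] 0) atTop := by
  refine (tendsto_rpow_atTop he).comp ?_
  have h := (tendsto_norm_inv_nhdsNE_zero_atTop (α := ℝ)).const_mul_atTop hrs
  refine h.congr fun s => ?_
  rw [Real.norm_eq_abs, abs_inv, abs_div, abs_of_pos hrs, div_eq_mul_inv]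

end

/-! ### Transfer from the closed form to the Kretschmann scalar. -/

theorem mainTheorem5 (rs k : ℝ) (hrs : 0 < rs) :
    -- closed form and positivity at every point of the coordinate domain
    (∀ t ρ θ φ : ℝ, ρ ≠ 0 → ρ ≠ rs → Real.sin θ ≠ 0 →
      kretschmann (specialMetric rs k) ![t, ρ, θ, φ] = kretschmannClosed rs k (xOf rs ρ) ∧
      0 < kretschmann (specialMetric rs k) ![t, ρ, θ, φ]) ∧
    -- behaviour at the origin and at the interior-exterior boundary, along every radial line
    (∀ t θ φ : ℝ, Real.sin θ ≠ 0 →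
      ((0 < 2 * zeta k - k + 1 ∧ 0 < polyB k - zeta k * polyA k ∧
        (fun ρ : ℝ => kretschmann (specialMetric rs k) ![t, ρ, θ, φ]) ~[𝓝[≠] 0]
          (fun ρ : ℝ => 2 / (zeta k ^ 8 * rs ^ 4) * (polyB k - zeta k * polyA k)
            * |rs / ρ| ^ (2 * (2 * zeta k - k + 1))) ∧
        Tendsto (fun ρ : ℝ => kretschmann (specialMetric rs k) ![t, ρ, θ, φ])
          (𝓝[≠] 0) atTop) ∧
      (k ≠ 0 → k ≠ -1 →
        1 - 2 * zeta k - k < 0 ∧ 0 < polyB k + zeta k * polyA k ∧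
        (fun ρ : ℝ => kretschmann (specialMetric rs k) ![t, ρ, θ, φ]) ~[𝓝[≠] rs]
          (fun ρ : ℝ => 2 / (zeta k ^ 8 * rs ^ 4) * (polyB k + zeta k * polyA k)
            * |xOf rs ρ| ^ (2 * (1 - 2 * zeta k - k))) ∧
        (fun ρ : ℝ => kretschmann (specialMetric rs k) ![t, ρ, θ, φ]) =Θ[𝓝[≠] rs]
          (fun ρ : ℝ => |ρ - rs| ^ (2 * (1 - 2 * zeta k - k))) ∧
        Tendsto (fun ρ : ℝ => kretschmann (specialMetric rs k) ![t, ρ, θ, φ])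
          (𝓝[≠] rs) atTop) ∧
      (k = 0 → Tendsto (fun ρ : ℝ => kretschmann (specialMetric rs k) ![t, ρ, θ, φ])
          (𝓝[≠] rs) (𝓝 (12 * (rs ^ 4)⁻¹))) ∧
      (k = -1 → Tendsto (fun ρ : ℝ => kretschmann (specialMetric rs k) ![t, ρ, θ, φ])
          (𝓝[≠] rs) (𝓝 (3 / 8 * (rs ^ 4)⁻¹))))) := by
  have hK : ∀ t ρ θ φ : ℝ, ρ ≠ 0 → ρ ≠ rs → Real.sin θ ≠ 0 →
      kretschmann (specialMetric rs k) ![t, ρ, θ, φ] = kretschmannClosed rs k (xOf rs ρ) :=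
    fun t ρ θ φ h0 hs hθ => kretschmann_specialMetric k hrs (p := ![t, ρ, θ, φ]) h0 hs hθ
  have hk := one_sub_abs_lt_two_zeta k
  have hz := zeta_pos k
  refine ⟨fun t ρ θ φ h0 hs hθ => ⟨hK t ρ θ φ h0 hs hθ, ?_⟩, fun t θ φ hθ => ?_⟩
  · rw [hK t ρ θ φ h0 hs hθ]
    exact kretschmannClosed_pos hrs (xOf_ne_zero h0 hs) (xOf_ne_one hrs h0)
  have hK0 : (fun ρ => kretschmann (specialMetric rs k) ![t, ρ, θ, φ]) =ᶠ[𝓝[≠] 0]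
      fun ρ => kretschmannClosed rs k (xOf rs ρ) := by
    filter_upwards [self_mem_nhdsWithin,
      (eventually_ne_nhds hrs.ne).filter_mono nhdsWithin_le_nhds] with ρ h0 hs
    exact hK t ρ θ φ h0 hs hθ
  have hKs : (fun ρ => kretschmann (specialMetric rs k) ![t, ρ, θ, φ]) =ᶠ[𝓝[≠] rs]
      fun ρ => kretschmannClosed rs k (xOf rs ρ) := by
    filter_upwards [self_mem_nhdsWithin,
      (eventually_ne_nhds hrs.ne').filter_mono nhdsWithin_le_nhds] with ρ hs h0
    exact hK t ρ θ φ h0 hs hθ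
  refine ⟨?_, fun h0 h1 => ?_, fun h => ?_, fun h => ?_⟩
  · have he : 0 < 2 * zeta k - k + 1 := by linarith [le_abs_self k]
    have hc := polyB_sub_pos k
    have hequiv := (kretschmannClosed_isEquivalent_zero k hrs).congr_left hK0.symm
    exact ⟨he, hc, hequiv, hequiv.symm.tendsto_atTop
      ((tendsto_abs_div_rpow hrs (by linarith)).const_mul_atTop (by positivity))⟩
  · have he : 1 - 2 * zeta k - k < 0 := by linarith [neg_le_abs k]
    have hc := polyB_add_pos h0 h1
    have hequiv := (kretschmannClosed_isEquivalent_horizon hrs h0 h1).congr_left hKs.symm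
    refine ⟨he, hc, hequiv, hequiv.isTheta.trans ?_, hequiv.symm.tendsto_atTop
      ((tendsto_abs_xOf_rpow hrs (by linarith)).const_mul_atTop (by positivity))⟩
    exact (abs_xOf_rpow_isTheta hrs _).const_mul_left (by positivity)
  · subst h
    refine ((tendsto_kretschmannClosed_horizon hrs ?_ ?_ ?_).congr' hKs.symm).mono_right
      (le_of_eq (congrArg 𝓝 ?_)) <;> norm_num [zeta_zero, polyA, polyB]
    ring
  · subst h
    refine ((tendsto_kretschmannClosed_horizon hrs ?_ ?_ ?_).congr' hKs.symm).mono_right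
      (le_of_eq (congrArg 𝓝 ?_)) <;> norm_num [zeta_neg_one, polyA, polyB]
    ring
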